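/- Let $d\ge 0$ and let $\langle x,\xi\rangle$ denote the inner product of $\mathbb R^d$. For $z=(x,\xi)\in\mathbb R^{2d}$ and $t\in\mathbb R$ let $\rho(z,t)$ be the unitary operator on $L^2(\mathbb R^d)$ given by $\rho(x,\xi,t)f(y)=e^{2\pi i t}e^{-\pi i\langle x,\xi\rangle}e^{2\pi i\langle\xi,y\rangle}f(y-x)$. For $A\in Sp(d,\mathbb R)$ let $\mu(A)$ be the metaplectic operator, i.e. a unitary operator on $L^2(\mathbb R^d)$ with $\rho(Az,t)=\mu(A)\rho(z,t)\mu(A)^{-1}$ for all $(z,t)$ (it exists and is unique up to a phase factor, which plays no role below). On $G=\mathbb R^{2d}\rtimes Sp(d,\mathbb R)$, with the law $(z,A)(z',A')=(z+Az',AA')$, put $\mu_e(z,A)=\rho(z,0)\mu(A)$. Let $K$ be a (second countable) Lie subgroup of $Sp(d,\mathbb R)$ with its own Lie group topology (for a closed subgroup, the subspace topology); more generally, let $K$ be a second countable locally compact group with a continuous injective homomorphism into $Sp(d,\mathbb R)$. Let $H=\mathbb R^{2d}\rtimes K\subset G$, with the product topology and a left Haar measure $dh$. Then $H$ is reproducing,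 i.e. there is $\phi\in L^2(\mathbb R^d)$ such that for all $f,g\in L^2(\mathbb R^d)$ $$\langle f,g\rangle=\int_H\langle f,\mu_e(h)\phi\rangle\,\langle\mu_e(h)\phi,g\rangle\,dh$$ with an absolutely convergent integral, if and only if $K$ is compact. Moreover, if $dk$ is a left Haar measure of $K$ then $dh=dx\,d\xi\,dk$ is a left Haar measure of $H$, and for all $f,\phi\in L^2(\mathbb R^d)$ the function $h\mapsto|\langle f,\mu_e(h)\phi\rangle|^2$ is measurable on $H$ and $$\int_H|\langle f,\mu_e(h)\phi\rangle|^2\,dh=\|f\|^2\,\|\phi\|^2\,\mathrm{mes}(K)\in[0,\infty],$$ where $\mathrm{mes}(K)=\int_K dk$ and $0\cdot\infty=0$. -/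

import Mathlib

open MeasureTheory
open scoped ENNReal NNReal FourierTransform SchwartzMap
namespace ExtMetaplectic
noncomputable section

/-- The configuration space `ℝ^d` with its Euclidean inner product and Lebesgue measure. -/
abbrev Conf (d : ℕ) : Type := EuclideanSpace ℝ (Fin d)

/-- The phase space `ℝ^{2d}`: points `z = (x, ξ)`, with Lebesgue measure `dx dξ`. -/
abbrev Phase (d : ℕ) : Type := Conf d × Conf d

/-- The Hilbert space `L²(ℝ^d)` of complex-valued functions. -/
abbrev L2 (d : ℕ) : Type := Lp ℂ 2 (volume : Measure (Conf d))

/-- The symplectic group `Sp(d, ℝ)` of real `2d × 2d` matrices. -/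
abbrev Sp (d : ℕ) : Type := ↥(Matrix.symplecticGroup (Fin d) ℝ)

/-- A weight `m` and a change of variable `e` of `ℝ^d` for which `f ↦ m · (f ∘ e)` is unitary on
`L²(ℝ^d)`: the image of Lebesgue measure under `e` is `c` times Lebesgue measure, `|m|² = 1 / c`. -/
structure WeightedChange (d : ℕ) where
  m : Conf d → ℂ
  e : Conf d ≃ᵐ Conf d
  c : ℝ≥0
  measurable_m : Measurable m
  map_e : (volume : Measure (Conf d)).map e = c • volume
  norm_m : ∀ y, c * ‖m y‖₊ ^ 2 = 1

namespace WeightedChange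
variable {d : ℕ} (w : WeightedChange d)

theorem c_ne_zero : w.c ≠ 0 := by
  intro h; simpa [h] using w.norm_m 0

theorem m_ne_zero (y : Conf d) : w.m y ≠ 0 := by
  intro h; simpa [h] using w.norm_m y

theorem quasi : Measure.QuasiMeasurePreserving w.e volume volume :=
  ⟨w.e.measurable, by rw [w.map_e]; exact Measure.smul_absolutelyContinuous⟩

theorem eLpNorm_eq (f : Conf d → ℂ) :
    eLpNorm (fun y ↦ w.m y * f (w.e y)) 2 volume = eLpNorm f 2 volume := by
  rw [eLpNorm_eq_lintegral_rpow_enorm_toReal (by simp) (by simp),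
    eLpNorm_eq_lintegral_rpow_enorm_toReal (by simp) (by simp)]
  congr 1
  have h1 : ∀ y, ‖w.m y‖ₑ ^ (2 : ℝ) = (w.c : ℝ≥0∞)⁻¹ := by
    intro y
    have := w.norm_m y
    rw [ENNReal.rpow_two, enorm_eq_nnnorm]
    refine ENNReal.eq_inv_of_mul_eq_one_left ?_
    rw [mul_comm]
    exact_mod_cast this
  have h2 : (w.c : ℝ≥0∞) ≠ 0 := by exact_mod_cast w.c_ne_zero
  simp only [enorm_mul, ENNReal.toReal_ofNat, ENNReal.mul_rpow_of_nonneg _ _ zero_le_two, h1]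
  rw [lintegral_const_mul' _ _ (by simpa using w.c_ne_zero)]
  rw [← w.e.measurableEmbedding.lintegral_map (f := fun y ↦ ‖f y‖ₑ ^ (2 : ℝ)), w.map_e,
    lintegral_smul_measure, ENNReal.smul_def, smul_eq_mul, ← mul_assoc,
    ENNReal.inv_mul_cancel h2 ENNReal.coe_ne_top, one_mul]

theorem memLp {f : Conf d → ℂ} (hf : MemLp f 2 volume) :
    MemLp (fun y ↦ w.m y * f (w.e y)) 2 volume :=
  ⟨w.measurable_m.aestronglyMeasurable.mul (hf.1.comp_quasiMeasurePreserving w.quasi),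
    by rw [w.eLpNorm_eq]; exact hf.2⟩

/-- The operator `f ↦ m · (f ∘ e)` on `L²`. -/
def isom : L2 d →ₗᵢ[ℂ] L2 d where
  toFun f := (w.memLp (Lp.memLp f)).toLp _
  map_add' f g := by
    rw [← MemLp.toLp_add]
    refine MemLp.toLp_congr _ _ ?_
    filter_upwards [w.quasi.ae (Lp.coeFn_add f g)] with y hy
    rw [hy, Pi.add_apply, mul_add]
    rfl
  map_smul' a f := by
    rw [RingHom.id_apply, ← MemLp.toLp_const_smul]
    refine MemLp.toLp_congr _ _ ?_
    filter_upwards [w.quasi.ae (Lp.coeFn_smul a f)] with y hy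
    rw [hy, Pi.smul_apply, Pi.smul_apply, smul_eq_mul, smul_eq_mul, mul_left_comm]
  norm_map' f := by
    change ‖(w.memLp (Lp.memLp f)).toLp _‖ = _
    rw [Lp.norm_toLp, w.eLpNorm_eq, Lp.norm_def]

theorem isom_coe (f : L2 d) : w.isom f =ᵐ[volume] fun y ↦ w.m y * f (w.e y) :=
  MemLp.coeFn_toLp (w.memLp (Lp.memLp f))

/-- The data of the inverse operator. -/
def inv : WeightedChange d where
  m y := (w.m (w.e.symm y))⁻¹
  e := w.e.symm
  c := w.c⁻¹
  measurable_m := (w.measurable_m.comp w.e.symm.measurable).inv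
  map_e := by
    have h := congrArg (fun μ ↦ w.c⁻¹ • Measure.map w.e.symm μ) w.map_e
    simp only [Measure.map_smul, MeasurableEquiv.map_symm_map] at h
    rw [h, smul_smul, inv_mul_cancel₀ w.c_ne_zero, one_smul]
  norm_m y := by
    have h := w.norm_m (w.e.symm y)
    have h2 : ‖w.m (w.e.symm y)‖₊ ≠ 0 := by simpa using w.m_ne_zero _
    have h3 := w.c_ne_zero
    rw [nnnorm_inv, inv_pow, ← mul_inv, h, inv_one]

theorem isom_surjective : Function.Surjective w.isom := by
  intro g
  refine ⟨w.inv.isom g, ?_⟩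
  apply Lp.ext
  filter_upwards [w.isom_coe (w.inv.isom g), w.quasi.ae (w.inv.isom_coe g)] with y h1 h2
  rw [h1, h2]
  simp [inv, mul_inv_cancel_left₀ (w.m_ne_zero y)]

/-- The unitary operator `f ↦ m · (f ∘ e)` on `L²`. -/
def unitary : L2 d ≃ₗᵢ[ℂ] L2 d := LinearIsometryEquiv.ofSurjective w.isom w.isom_surjective

theorem unitary_coe (f : L2 d) : w.unitary f =ᵐ[volume] fun y ↦ w.m y * f (w.e y) :=
  w.isom_coe f

end WeightedChange
/-- The weight `y ↦ e^{2πit} e^{-πi⟨x,ξ⟩} e^{2πi⟨ξ,y⟩}` and the translation `y ↦ y - x`. -/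
def schrodingerData {d : ℕ} (z : Phase d) (t : ℝ) : WeightedChange d where
  m y := Complex.exp (2 * Real.pi * Complex.I * t)
    * Complex.exp (-(Real.pi * Complex.I * (inner ℝ z.1 z.2 : ℝ)))
    * Complex.exp (2 * Real.pi * Complex.I * (inner ℝ z.2 y : ℝ))
  e := MeasurableEquiv.subRight z.1
  c := 1
  measurable_m := by fun_prop
  map_e := by
    rw [one_smul]
    exact (measurePreserving_sub_right volume z.1).map_eq
  norm_m y := by
    have h : ∀ r : ℝ, ‖Complex.exp (r * Complex.I)‖₊ = 1 := fun r ↦ by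
      ext; simp
    have h1 := h (2 * Real.pi * t)
    have h2 := h (-(Real.pi * inner ℝ z.1 z.2))
    have h3 := h (2 * Real.pi * inner ℝ z.2 y)
    push_cast at h1 h2 h3
    rw [nnnorm_mul, nnnorm_mul]
    rw [show (2 * Real.pi * Complex.I * t : ℂ) = 2 * Real.pi * t * Complex.I by ring,
      show (-(Real.pi * Complex.I * (inner ℝ z.1 z.2 : ℝ)) : ℂ)
        = -(Real.pi * (inner ℝ z.1 z.2 : ℝ)) * Complex.I by ring,
      show (2 * Real.pi * Complex.I * (inner ℝ z.2 y : ℝ) : ℂ)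
        = 2 * Real.pi * (inner ℝ z.2 y : ℝ) * Complex.I by ring, h1, h2, h3]
    simp

/-- The unitary operator `ρ(x, ξ, t)` of the Schrödinger representation on `L²(ℝ^d)`:
`ρ(x, ξ, t) f (y) = e^{2πit} e^{-πi⟨x,ξ⟩} e^{2πi⟨ξ,y⟩} f(y - x)`. -/
def schrodinger {d : ℕ} (z : Phase d) (t : ℝ) : L2 d ≃ₗᵢ[ℂ] L2 d := (schrodingerData z t).unitary

theorem schrodinger_coe {d : ℕ} (z : Phase d) (t : ℝ) (f : L2 d) :
    schrodinger z t f =ᵐ[volume] fun y ↦ Complex.exp (2 * Real.pi * Complex.I * t)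
      * Complex.exp (-(Real.pi * Complex.I * (inner ℝ z.1 z.2 : ℝ)))
      * Complex.exp (2 * Real.pi * Complex.I * (inner ℝ z.2 y : ℝ)) * f (y - z.1) :=
  (schrodingerData z t).unitary_coe f

theorem quasi_sub {d : ℕ} (x : Conf d) :
    Measure.QuasiMeasurePreserving (fun y : Conf d ↦ y - x) volume volume :=
  (measurePreserving_sub_right volume x).quasiMeasurePreserving

theorem schrodinger_mul {d : ℕ} (z z' : Phase d) (t t' : ℝ) :
    schrodinger z t * schrodinger z' t' = schrodinger (z + z')
      (t + t' - (inner ℝ z.1 z'.2 - inner ℝ z.2 z'.1) / 2) := by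
  ext1 f
  apply Lp.ext
  rw [LinearIsometryEquiv.coe_mul, Function.comp_apply]
  filter_upwards [schrodinger_coe z t (schrodinger z' t' f), schrodinger_coe (z + z')
    (t + t' - (inner ℝ z.1 z'.2 - inner ℝ z.2 z'.1) / 2) f,
    (quasi_sub z.1).ae (schrodinger_coe z' t' f)] with y h1 h2 h3
  rw [h1, h2, h3, Prod.fst_add, Prod.snd_add, sub_sub]
  simp only [← mul_assoc, ← Complex.exp_add]
  congr 2
  simp only [inner_add_left, inner_add_right, inner_sub_right]
  rw [real_inner_comm z.1 z'.2, real_inner_comm z'.1 z.2]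
  push_cast
  ring

theorem schrodinger_phase {d : ℕ} (z : Phase d) (t : ℝ) (f : L2 d) :
    schrodinger z t f = Complex.exp (2 * Real.pi * Complex.I * t) • schrodinger z 0 f := by
  apply Lp.ext
  filter_upwards [schrodinger_coe z t f, schrodinger_coe z 0 f,
    Lp.coeFn_smul (Complex.exp (2 * Real.pi * Complex.I * t)) (schrodinger z 0 f)] with y h1 h2 h3
  rw [h3, Pi.smul_apply, h1, h2]
  simp [mul_assoc]

theorem schrodinger_toLp {d : ℕ} (x : Conf d) (s : 𝓢(Conf d, ℂ)) :
    schrodinger (x, 0) 0 (s.toLp 2) = (SchwartzMap.compSubConstCLM ℂ x s).toLp 2 := by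
  apply Lp.ext
  filter_upwards [schrodinger_coe (x, 0) 0 (s.toLp 2), (quasi_sub x).ae (s.coeFn_toLp 2 volume),
    (SchwartzMap.compSubConstCLM ℂ x s).coeFn_toLp 2 volume] with y h1 h2 h3
  rw [h1, h3, h2]
  simp

/-- The Fourier transform turns translations into modulations. -/
theorem fourier_shift {d : ℕ} (x : Conf d) (f : L2 d) :
    𝓕 (schrodinger (x, 0) 0 f) = schrodinger (0, -x) 0 (𝓕 f) := by
  have hd := SchwartzMap.denseRange_toLpCLM (E := Conf d) (F := ℂ) (p := 2)
    (μ := volume) ENNReal.ofNat_ne_top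
  refine hd.induction_on (p := fun f ↦ 𝓕 (schrodinger (x, 0) 0 f)
    = schrodinger (0, -x) 0 (𝓕 f)) f ?_ ?_
  · refine isClosed_eq ?_ ?_
    · exact (Lp.fourierTransformₗᵢ (Conf d) ℂ).continuous.comp (schrodinger (x, 0) 0).continuous
    · exact (schrodinger (0, -x) 0).continuous.comp (Lp.fourierTransformₗᵢ (Conf d) ℂ).continuous
  · intro s
    rw [SchwartzMap.toLpCLM_apply, schrodinger_toLp, SchwartzMap.toLp_fourier_eq,
      SchwartzMap.toLp_fourier_eq]
    apply Lp.ext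
    filter_upwards [schrodinger_coe (0, -x) 0 ((𝓕 s).toLp 2), (𝓕 s).coeFn_toLp 2 volume,
      (𝓕 (SchwartzMap.compSubConstCLM ℂ x s)).coeFn_toLp 2 volume] with y h1 h2 h3
    rw [h1, h3]
    simp only [sub_zero]
    rw [h2, SchwartzMap.fourier_coe, SchwartzMap.fourier_coe, Real.fourier_eq', Real.fourier_eq']
    rw [← integral_add_right_eq_self _ x, ← integral_const_mul]
    congr 1
    ext v
    simp only [SchwartzMap.compSubConstCLM_apply, add_sub_cancel_right, smul_eq_mul, ← mul_assoc,
      ← Complex.exp_add]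
    congr 2
    simp [inner_add_left]
    ring

theorem fourierInv_shift {d : ℕ} (x : Conf d) (f : L2 d) :
    𝓕⁻ (schrodinger (x, 0) 0 f) = schrodinger (0, x) 0 (𝓕⁻ f) := by
  have hd := SchwartzMap.denseRange_toLpCLM (E := Conf d) (F := ℂ) (p := 2)
    (μ := volume) ENNReal.ofNat_ne_top
  refine hd.induction_on (p := fun f ↦ 𝓕⁻ (schrodinger (x, 0) 0 f)
    = schrodinger (0, x) 0 (𝓕⁻ f)) f ?_ ?_
  · refine isClosed_eq ?_ ?_
    · exact (Lp.fourierTransformₗᵢ (Conf d) ℂ).symm.continuous.comp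
        (schrodinger (x, 0) 0).continuous
    · exact (schrodinger (0, x) 0).continuous.comp
        (Lp.fourierTransformₗᵢ (Conf d) ℂ).symm.continuous
  · intro s
    rw [SchwartzMap.toLpCLM_apply, schrodinger_toLp, SchwartzMap.toLp_fourierInv_eq,
      SchwartzMap.toLp_fourierInv_eq]
    apply Lp.ext
    filter_upwards [schrodinger_coe (0, x) 0 ((𝓕⁻ s).toLp 2), (𝓕⁻ s).coeFn_toLp 2 volume,
      (𝓕⁻ (SchwartzMap.compSubConstCLM ℂ x s)).coeFn_toLp 2 volume] with y h1 h2 h3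
    rw [h1, h3]
    simp only [sub_zero]
    rw [h2, SchwartzMap.fourierInv_coe, SchwartzMap.fourierInv_coe, Real.fourierInv_eq',
      Real.fourierInv_eq']
    rw [← integral_add_right_eq_self _ x, ← integral_const_mul]
    congr 1
    ext v
    simp only [SchwartzMap.compSubConstCLM_apply, add_sub_cancel_right, smul_eq_mul, ← mul_assoc,
      ← Complex.exp_add]
    congr 2
    simp [inner_add_left]
    ring

theorem fourier_schrodinger {d : ℕ} (x ξ : Conf d) (t : ℝ) (f : L2 d) :
    𝓕 (schrodinger (x, ξ) t f) = schrodinger (ξ, -x) t (𝓕 f) := by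
  have h1 : schrodinger (x, ξ) t
      = schrodinger (0, ξ) 0 * schrodinger (x, 0) (t - inner ℝ x ξ / 2) := by
    rw [schrodinger_mul]
    congr 1
    · simp
    · simp only [real_inner_comm x ξ, inner_zero_left, zero_add]
      ring
  have h2 : schrodinger (ξ, -x) t
      = schrodinger (ξ, 0) 0 * schrodinger (0, -x) (t - inner ℝ x ξ / 2) := by
    rw [schrodinger_mul]
    congr 1
    · simp
    · simp only [real_inner_comm x ξ, inner_zero_left, inner_neg_right, zero_add]
      ring
  have h3 : ∀ g : L2 d, 𝓕 (schrodinger (0, ξ) 0 g) = schrodinger (ξ, 0) 0 (𝓕 g) := fun g ↦ by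
    have := congrArg (fun u : L2 d ↦ 𝓕 u) (fourierInv_shift ξ (𝓕 g))
    simp only [FourierTransform.fourier_fourierInv_eq, FourierTransform.fourierInv_fourier_eq]
      at this
    exact this.symm
  rw [h1, h2, LinearIsometryEquiv.coe_mul, LinearIsometryEquiv.coe_mul, Function.comp_apply,
    Function.comp_apply, h3, schrodinger_phase (x, 0), schrodinger_phase (0, -x),
    FourierTransform.fourier_smul, fourier_shift]

open Matrix in
/-- The linear action `z ↦ A z` of a symplectic matrix on phase space. -/
def act {d : ℕ} (A : Sp d) (z : Phase d) : Phase d :=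
  (WithLp.toLp 2 fun i ↦ (A.1 *ᵥ Sum.elim z.1 z.2) (Sum.inl i),
    WithLp.toLp 2 fun i ↦ (A.1 *ᵥ Sum.elim z.1 z.2) (Sum.inr i))

open Matrix in
theorem elim_act {d : ℕ} (A : Sp d) (z : Phase d) :
    (Sum.elim (act A z).1 (act A z).2 : Fin d ⊕ Fin d → ℝ) = A.1 *ᵥ Sum.elim z.1 z.2 := by
  ext i
  cases i <;> rfl

theorem phase_ext {d : ℕ} {z z' : Phase d}
    (h : (Sum.elim z.1 z.2 : Fin d ⊕ Fin d → ℝ) = Sum.elim z'.1 z'.2) : z = z' := by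
  obtain ⟨h1, h2⟩ := Sum.elim_eq_iff.1 h
  exact Prod.ext (PiLp.ext fun i ↦ congrFun h1 i) (PiLp.ext fun i ↦ congrFun h2 i)

theorem act_one {d : ℕ} (z : Phase d) : act 1 z = z := by
  apply phase_ext
  rw [elim_act]
  exact Matrix.one_mulVec _

theorem act_mul {d : ℕ} (A B : Sp d) (z : Phase d) : act (A * B) z = act A (act B z) := by
  apply phase_ext
  rw [elim_act, elim_act, elim_act, Matrix.mulVec_mulVec]
  rfl

theorem act_add {d : ℕ} (A : Sp d) (z z' : Phase d) : act A (z + z') = act A z + act A z' := by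
  apply phase_ext
  have h : ∀ z z' : Phase d, (Sum.elim (z + z').1 (z + z').2 : Fin d ⊕ Fin d → ℝ)
      = Sum.elim z.1 z.2 + Sum.elim z'.1 z'.2 := by
    intro z z'
    ext i
    cases i <;> rfl
  rw [elim_act, h, Matrix.mulVec_add, h, elim_act, elim_act]

/-- The unitary `U` intertwines `ρ` with `ρ_A = ρ(A ·)`, that is, `ρ(A z, t) = U ρ(z, t) U⁻¹` for
all `(z, t)`. This property determines the metaplectic operator `μ(A)` up to a phase factor. -/
def IsMetaplectic {d : ℕ} (A : Sp d) (U : L2 d ≃ₗᵢ[ℂ] L2 d) : Prop :=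
  ∀ (z : Phase d) (t : ℝ), schrodinger (act A z) t = U * schrodinger z t * U⁻¹

theorem isMetaplectic_of {d : ℕ} {A : Sp d} {U : L2 d ≃ₗᵢ[ℂ] L2 d}
    (h : ∀ z t f, schrodinger (act A z) t (U f) = U (schrodinger z t f)) : IsMetaplectic A U := by
  intro z t
  rw [eq_mul_inv_iff_mul_eq]
  ext1 f
  exact h z t f

/-- The symplectic matrices that have a metaplectic operator (all of them, as shown below). -/
def metaplecticDomain (d : ℕ) : Subgroup (Sp d) where
  carrier := {A | ∃ U, IsMetaplectic A U}
  one_mem' := ⟨1, fun z t ↦ by rw [act_one]; group⟩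
  mul_mem' := by
    rintro A B ⟨U, hU⟩ ⟨V, hV⟩
    refine ⟨U * V, fun z t ↦ ?_⟩
    rw [act_mul, hU, hV]
    group
  inv_mem' := by
    rintro A ⟨U, hU⟩
    refine ⟨U⁻¹, fun z t ↦ ?_⟩
    have h := hU (act A⁻¹ z) t
    rw [← act_mul, mul_inv_cancel, act_one] at h
    rw [h]
    group

/-- Multiplication by the chirp `y ↦ e^{πi⟨y, C y⟩}`. -/
def chirpData {d : ℕ} (C : Conf d →L[ℝ] Conf d) : WeightedChange d where
  m y := Complex.exp (Real.pi * Complex.I * (inner ℝ y (C y) : ℝ))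
  e := MeasurableEquiv.refl _
  c := 1
  measurable_m := by fun_prop
  map_e := by
    rw [one_smul]
    exact Measure.map_id
  norm_m y := by
    rw [show (Real.pi * Complex.I * (inner ℝ y (C y) : ℝ) : ℂ)
      = ((Real.pi * inner ℝ y (C y) : ℝ) : ℂ) * Complex.I by push_cast; ring]
    ext
    rw [NNReal.coe_mul, NNReal.coe_pow, coe_nnnorm, Complex.norm_exp_ofReal_mul_I]
    simp

theorem mem_of_shear {d : ℕ} (A : Sp d) (C : Conf d →L[ℝ] Conf d)
    (hC : ∀ x y, inner ℝ x (C y) = inner ℝ (C x) y)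
    (hA : ∀ z, act A z = (z.1, z.2 + C z.1)) : A ∈ metaplecticDomain d := by
  refine ⟨(chirpData C).unitary, isMetaplectic_of fun z t f ↦ ?_⟩
  apply Lp.ext
  filter_upwards [schrodinger_coe (act A z) t ((chirpData C).unitary f),
    (quasi_sub (act A z).1).ae ((chirpData C).unitary_coe f),
    (chirpData C).unitary_coe (schrodinger z t f), schrodinger_coe z t f] with y h1 h2 h3 h4
  rw [h1, h2, h3]
  have h5 : ∀ x, (chirpData C).e x = x := fun _ ↦ rfl
  rw [h5, h5, h4, hA]
  simp only [chirpData]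
  simp only [← mul_assoc, ← Complex.exp_add]
  congr 2
  simp only [map_sub, inner_sub_left, inner_sub_right, inner_add_left, inner_add_right]
  rw [← hC z.1 y, real_inner_comm (C z.1) y, ← hC z.1 y]
  push_cast
  ring

/-- The dilation `f ↦ |det L|^{1/2} f(L ·)`. -/
def dilationData {d : ℕ} (L : Conf d ≃L[ℝ] Conf d) : WeightedChange d where
  m _ := ((Real.sqrt |LinearMap.det (L : Conf d →ₗ[ℝ] Conf d)| : ℝ) : ℂ)
  e := L.toHomeomorph.toMeasurableEquiv
  c := Real.toNNReal |(LinearMap.det (L : Conf d →ₗ[ℝ] Conf d))⁻¹|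
  measurable_m := measurable_const
  map_e := Measure.map_linearMap_addHaar_eq_smul_addHaar (volume : Measure (Conf d))
    (LinearEquiv.isUnit_det' L.toLinearEquiv).ne_zero
  norm_m y := by
    have h : LinearMap.det (L : Conf d →ₗ[ℝ] Conf d) ≠ 0 :=
      (LinearEquiv.isUnit_det' L.toLinearEquiv).ne_zero
    ext
    rw [NNReal.coe_mul, NNReal.coe_pow, coe_nnnorm, Complex.norm_real, Real.norm_eq_abs,
      abs_of_nonneg (Real.sqrt_nonneg _), Real.sq_sqrt (abs_nonneg _),
      Real.coe_toNNReal _ (abs_nonneg _), abs_inv, inv_mul_cancel₀ (abs_ne_zero.2 h)]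
    rfl

theorem mem_of_dilation {d : ℕ} (A : Sp d) (L : Conf d ≃L[ℝ] Conf d) (L' : Conf d → Conf d)
    (hL : ∀ x y, inner ℝ (L' x) y = inner ℝ x (L y))
    (hA : ∀ z, act A z = (L.symm z.1, L' z.2)) : A ∈ metaplecticDomain d := by
  refine ⟨(dilationData L).unitary, isMetaplectic_of fun z t f ↦ ?_⟩
  apply Lp.ext
  filter_upwards [schrodinger_coe (act A z) t ((dilationData L).unitary f),
    (quasi_sub (act A z).1).ae ((dilationData L).unitary_coe f),
    (dilationData L).unitary_coe (schrodinger z t f),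
    (dilationData L).quasi.ae (schrodinger_coe z t f)] with y h1 h2 h3 h4
  rw [h1, h2, h3]
  simp only [dilationData] at h4 ⊢
  have h5 : ∀ x, (L.toHomeomorph.toMeasurableEquiv : Conf d → Conf d) x = L x := fun _ ↦ rfl
  simp only [h5] at h4 ⊢
  rw [h4, hA]
  simp only [hL, map_sub, ContinuousLinearEquiv.apply_symm_apply, real_inner_comm (L' z.2)]
  rw [real_inner_comm z.1 z.2]
  ring

theorem mem_of_fourier {d : ℕ} (A : Sp d) (hA : ∀ z, act A z = (z.2, -z.1)) :
    A ∈ metaplecticDomain d := by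
  refine ⟨Lp.fourierTransformₗᵢ (Conf d) ℂ, isMetaplectic_of fun z t f ↦ ?_⟩
  rw [hA]
  exact (fourier_schrodinger z.1 z.2 t f).symm

open Matrix in
/-- The polynomial `t ↦ det (A + t C)` is not identically zero, since it does not vanish at `i`. -/
theorem exists_isUnit_add_smul {d : ℕ} (A C : Matrix (Fin d) (Fin d) ℝ) (hsymm : Aᵀ * C = Cᵀ * A)
    (hker : ∀ x : Fin d → ℝ, A *ᵥ x = 0 → C *ᵥ x = 0 → x = 0) :
    ∃ t : ℝ, IsUnit (A + t • C) := by
  set p : Polynomial ℝ :=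
    (A.map Polynomial.C + (Polynomial.X : Polynomial ℝ) • C.map Polynomial.C).det with hp
  have hev : ∀ t : ℝ, p.eval t = (A + t • C).det := by
    intro t
    rw [hp, ← Polynomial.coe_evalRingHom, RingHom.map_det]
    congr 1
    ext i j
    simp
    ring
  have hI : Polynomial.aeval Complex.I p
      = (A.map (algebraMap ℝ ℂ) + Complex.I • C.map (algebraMap ℝ ℂ)).det := by
    rw [hp, AlgHom.map_det]
    congr 1
    ext i j
    simp
    ring
  have hp0 : p ≠ 0 := by
    intro h0
    rw [h0, map_zero] at hI
    obtain ⟨v, hv, hv0⟩ := Matrix.exists_mulVec_eq_zero_iff.2 hI.symm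
    set x : Fin d → ℝ := fun i ↦ (v i).re with hx
    set y : Fin d → ℝ := fun i ↦ (v i).im with hy
    have e1 : A *ᵥ x = C *ᵥ y := by
      ext i
      have := congrArg Complex.re (congrFun hv0 i)
      simp [Matrix.mulVec, dotProduct, add_mul, Finset.sum_add_distrib] at this
      simp only [Matrix.mulVec, dotProduct, hx, hy]
      linarith
    have e2 : A *ᵥ y = -(C *ᵥ x) := by
      ext i
      have := congrArg Complex.im (congrFun hv0 i)
      simp [Matrix.mulVec, dotProduct, add_mul, Finset.sum_add_distrib] at this
      simp only [Pi.neg_apply, Matrix.mulVec, dotProduct, hx, hy]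
      linarith
    have e3 : (A *ᵥ x) ⬝ᵥ (C *ᵥ y) = (C *ᵥ x) ⬝ᵥ (A *ᵥ y) := by
      rw [← Matrix.vecMul_transpose A x, ← Matrix.vecMul_transpose C x,
        ← Matrix.dotProduct_mulVec, ← Matrix.dotProduct_mulVec, Matrix.mulVec_mulVec,
        Matrix.mulVec_mulVec, hsymm]
    rw [e1, e2, dotProduct_neg] at e3
    have n1 : 0 ≤ (C *ᵥ x) ⬝ᵥ (C *ᵥ x) := Finset.sum_nonneg fun i _ ↦ mul_self_nonneg _
    have n2 : 0 ≤ (C *ᵥ y) ⬝ᵥ (C *ᵥ y) := Finset.sum_nonneg fun i _ ↦ mul_self_nonneg _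
    have c1 : C *ᵥ x = 0 := dotProduct_self_eq_zero.1 (by linarith)
    have c2 : C *ᵥ y = 0 := dotProduct_self_eq_zero.1 (by linarith)
    have x0 := hker x (e1.trans c2) c1
    have y0 := hker y (by rw [e2, c1, neg_zero]) c2
    exact hv (funext fun i ↦ Complex.ext (congrFun x0 i) (congrFun y0 i))
  by_contra! hne
  refine hp0 (Polynomial.eq_zero_of_infinite_isRoot p ?_)
  refine Set.infinite_univ.mono fun t _ ↦ ?_
  have := hne t
  rw [Matrix.isUnit_iff_isUnit_det, isUnit_iff_ne_zero, not_not] at this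
  rw [Set.mem_ofPred_eq, Polynomial.IsRoot, hev, this]

/-- The matrix `M` is symplectic and has a metaplectic operator. -/
def HasMetaplectic {d : ℕ} (M : Matrix (Fin d ⊕ Fin d) (Fin d ⊕ Fin d) ℝ) : Prop :=
  ∃ h : M ∈ Matrix.symplecticGroup (Fin d) ℝ, (⟨M, h⟩ : Sp d) ∈ metaplecticDomain d

theorem HasMetaplectic.mul {d : ℕ} {M N : Matrix (Fin d ⊕ Fin d) (Fin d ⊕ Fin d) ℝ}
    (hM : HasMetaplectic M) (hN : HasMetaplectic N) : HasMetaplectic (M * N) := by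
  obtain ⟨h, h'⟩ := hM
  obtain ⟨k, k'⟩ := hN
  have hmk : M * N ∈ Matrix.symplecticGroup (Fin d) ℝ := mul_mem h k
  have e : (⟨M * N, hmk⟩ : Sp d) = ⟨M, h⟩ * ⟨N, k⟩ := rfl
  refine ⟨hmk, ?_⟩
  rw [e]
  exact (metaplecticDomain d).mul_mem h' k'

theorem HasMetaplectic.of_mul {d : ℕ} {M N : Matrix (Fin d ⊕ Fin d) (Fin d ⊕ Fin d) ℝ}
    (hM : HasMetaplectic M) (hN : N ∈ Matrix.symplecticGroup (Fin d) ℝ)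
    (hMN : HasMetaplectic (M * N)) : HasMetaplectic N := by
  obtain ⟨h, h'⟩ := hM
  obtain ⟨k, k'⟩ := hMN
  exact ⟨hN, (Subgroup.mul_mem_cancel_left _ h').1 (show (⟨M, h⟩ * ⟨N, hN⟩ : Sp d) ∈ _ from k')⟩

open Matrix in
theorem hasMetaplectic_lower {d : ℕ} (C : Matrix (Fin d) (Fin d) ℝ) (hC : Cᵀ = C) :
    HasMetaplectic (fromBlocks 1 0 C 1) := by
  have hmem : fromBlocks 1 0 C 1 ∈ symplecticGroup (Fin d) ℝ := by
    rw [SymplecticGroup.fromBlocks_mem_iff]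
    simp [hC]
  refine ⟨hmem, mem_of_shear _ (LinearMap.toContinuousLinearMap (Matrix.toEuclideanLin C)) ?_ ?_⟩
  · intro x y
    have := Matrix.toEuclideanLin_conjTranspose_eq_adjoint C
    rw [conjTranspose_eq_transpose_of_trivial, hC] at this
    simp only [LinearMap.coe_toContinuousLinearMap']
    nth_rw 1 [this]
    rw [LinearMap.adjoint_inner_right]
  · intro z
    apply phase_ext
    rw [elim_act, fromBlocks_mulVec]
    ext i
    rcases i with i | i
    · simp
    · simp [add_comm, Matrix.toLpLin_apply]

open Matrix in
theorem hasMetaplectic_dilation {d : ℕ} (P : Matrix (Fin d) (Fin d) ℝ) (hP : IsUnit P) :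
    HasMetaplectic (fromBlocks P⁻¹ 0 0 Pᵀ) := by
  have hdet : IsUnit P.det := (Matrix.isUnit_iff_isUnit_det P).1 hP
  have hmem : fromBlocks P⁻¹ 0 0 Pᵀ ∈ symplecticGroup (Fin d) ℝ := by
    rw [SymplecticGroup.fromBlocks_mem_iff]
    simp [← transpose_mul, mul_nonsing_inv P hdet]
  have l1 : ∀ x, toEuclideanLin P⁻¹ (toEuclideanLin P x) = x := fun x ↦ by
    simp [toLpLin_apply, mulVec_mulVec, nonsing_inv_mul P hdet]
  have l2 : ∀ x, toEuclideanLin P (toEuclideanLin P⁻¹ x) = x := fun x ↦ by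
    simp [toLpLin_apply, mulVec_mulVec, mul_nonsing_inv P hdet]
  let L : Conf d ≃L[ℝ] Conf d := LinearEquiv.toContinuousLinearEquiv
    { toEuclideanLin P with
      invFun := toEuclideanLin P⁻¹
      left_inv := l1
      right_inv := l2 }
  refine ⟨hmem, mem_of_dilation _ L (toEuclideanLin Pᵀ) ?_ ?_⟩
  · intro x y
    have := Matrix.toEuclideanLin_conjTranspose_eq_adjoint P
    rw [conjTranspose_eq_transpose_of_trivial] at this
    rw [this, LinearMap.adjoint_inner_left]
    rfl
  · intro z
    have hs : L.symm z.1 = toEuclideanLin P⁻¹ z.1 := rfl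
    rw [hs]
    apply phase_ext
    rw [elim_act, fromBlocks_mulVec]
    ext i
    rcases i with i | i <;> simp [toLpLin_apply]

open Matrix in
theorem hasMetaplectic_rot {d : ℕ} :
    HasMetaplectic (fromBlocks 0 1 (-1) 0 : Matrix (Fin d ⊕ Fin d) (Fin d ⊕ Fin d) ℝ) := by
  have hmem : fromBlocks 0 1 (-1) 0 ∈ symplecticGroup (Fin d) ℝ := by
    rw [SymplecticGroup.fromBlocks_mem_iff]
    simp
  refine ⟨hmem, mem_of_fourier _ fun z ↦ ?_⟩
  apply phase_ext
  rw [elim_act, fromBlocks_mulVec]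
  ext i
  rcases i with i | i <;> simp [neg_mulVec]

open Matrix in
theorem hasMetaplectic_upper {d : ℕ} (B : Matrix (Fin d) (Fin d) ℝ) (hB : Bᵀ = B) :
    HasMetaplectic (fromBlocks 1 B 0 1) := by
  have hJ : HasMetaplectic (fromBlocks 0 (-1) 1 0 : Matrix (Fin d ⊕ Fin d) (Fin d ⊕ Fin d) ℝ) := by
    refine hasMetaplectic_rot.of_mul (SymplecticGroup.J_mem _ _) ?_
    rw [fromBlocks_multiply]
    simpa using hasMetaplectic_lower (d := d) 0 (by simp)
  have := (hasMetaplectic_rot.mul (hasMetaplectic_lower (-B) (by simp [hB]))).mul hJ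
  simpa [fromBlocks_multiply] using this

open Matrix in
/-- Every symplectic matrix has a metaplectic operator. -/
theorem exists_isMetaplectic {d : ℕ} (A : Sp d) : ∃ U, IsMetaplectic A U := by
  suffices h : HasMetaplectic A.1 from h.2
  obtain ⟨M, hM⟩ := A
  obtain ⟨a, b, c, e, rfl⟩ : ∃ a b c e, M = fromBlocks a b c e :=
    ⟨_, _, _, _, (fromBlocks_toBlocks M).symm⟩
  change HasMetaplectic (fromBlocks a b c e)
  obtain ⟨t, ht⟩ := exists_isUnit_add_smul a c (SymplecticGroup.fromBlocks_mem_iff.1 hM).1 (by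
    intro x hx hx'
    have hu : IsUnit (fromBlocks a b c e) :=
      (Matrix.isUnit_iff_isUnit_det _).2 (SymplecticGroup.symplectic_det hM)
    have h0 : fromBlocks a b c e *ᵥ Sum.elim x 0 = fromBlocks a b c e *ᵥ Sum.elim 0 0 := by
      simp [fromBlocks_mulVec, hx, hx']
    exact (Sum.elim_eq_iff.1 (mulVec_injective_iff_isUnit.2 hu h0)).1)
  have h1 : HasMetaplectic (fromBlocks 1 (t • 1 : Matrix (Fin d) (Fin d) ℝ) 0 1) :=
    hasMetaplectic_upper _ (by simp)
  have hM1 := mul_mem h1.1 hM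
  refine h1.of_mul hM ?_
  rw [fromBlocks_multiply] at hM1 ⊢
  simp only [one_mul, zero_mul, zero_add, smul_mul_assoc] at hM1 ⊢
  set a' := a + t • c with ha'
  set b' := b + t • e
  have hdet : IsUnit a'.det := (Matrix.isUnit_iff_isUnit_det a').1 ht
  have hs := (SymplecticGroup.fromBlocks_mem_iff.1 hM1).1
  have h2 : HasMetaplectic (fromBlocks 1 0 (-(c * a'⁻¹)) 1) := by
    refine hasMetaplectic_lower _ ?_
    have hdet' : IsUnit a'ᵀ.det := by rwa [det_transpose]
    rw [transpose_neg, transpose_mul, transpose_nonsing_inv, neg_inj]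
    calc a'ᵀ⁻¹ * cᵀ = a'ᵀ⁻¹ * (cᵀ * a') * a'⁻¹ := by
          rw [← mul_assoc, mul_nonsing_inv_cancel_right _ _ hdet]
      _ = c * a'⁻¹ := by rw [← hs, nonsing_inv_mul_cancel_left _ _ hdet']
  have hM2 := mul_mem h2.1 hM1
  refine h2.of_mul hM1 ?_
  rw [fromBlocks_multiply] at hM2 ⊢
  simp only [one_mul, zero_mul, add_zero, neg_mul,
    nonsing_inv_mul_cancel_right _ _ hdet, neg_add_cancel] at hM2 ⊢
  have h3 := hasMetaplectic_dilation a' ht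
  have hM3 := mul_mem h3.1 hM2
  refine h3.of_mul hM2 ?_
  rw [fromBlocks_multiply] at hM3 ⊢
  simp only [mul_zero, zero_mul, zero_add, add_zero, nonsing_inv_mul _ hdet] at hM3 ⊢
  obtain ⟨-, k2, k3⟩ := SymplecticGroup.fromBlocks_mem_iff.1 hM3
  simp only [transpose_one, one_mul, transpose_zero, zero_mul, sub_zero] at k3
  rw [k3] at k2 ⊢
  refine hasMetaplectic_upper _ ?_
  simpa using k2

/-- The metaplectic operator `μ(A)`. The phase factor that the intertwining property leaves open is
chosen arbitrarily for each `A`; everything below is insensitive to it. -/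
def metaplectic {d : ℕ} (A : Sp d) : L2 d ≃ₗᵢ[ℂ] L2 d := (exists_isMetaplectic A).choose

theorem isMetaplectic_metaplectic {d : ℕ} (A : Sp d) : IsMetaplectic A (metaplectic A) :=
  (exists_isMetaplectic A).choose_spec

/-- The semidirect product `ℝ^{2d} ⋊ K` for a group `K` that acts on phase space through
`ι : K → Sp(d, ℝ)`. When `ι` is injective this is the subgroup `ℝ^{2d} ⋊ ι(K)` of
`ℝ^{2d} ⋊ Sp(d, ℝ)`. -/
structure PhaseSemidirect {d : ℕ} {K : Type*} [Group K] (ι : K →* Sp d) where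
  /-- the phase-space translation -/
  z : Phase d
  /-- the symplectic factor -/
  k : K

namespace PhaseSemidirect
variable {d : ℕ} {K : Type*} [Group K] (ι : K →* Sp d)

/-- The group law is `(z, k) (z', k') = (z + k z', k k')`. -/
instance : Group (PhaseSemidirect ι) where
  mul g h := ⟨g.z + act (ι g.k) h.z, g.k * h.k⟩
  one := ⟨0, 1⟩
  inv g := ⟨act (ι g.k⁻¹) (-g.z), g.k⁻¹⟩
  mul_assoc g h l := by
    change PhaseSemidirect.mk (g.z + act (ι g.k) h.z + act (ι (g.k * h.k)) l.z) (g.k * h.k * l.k)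
      = ⟨g.z + act (ι g.k) (h.z + act (ι h.k) l.z), g.k * (h.k * l.k)⟩
    rw [map_mul, act_mul, act_add, add_assoc, mul_assoc]
  one_mul g := by
    change PhaseSemidirect.mk (0 + act (ι 1) g.z) (1 * g.k) = g
    rw [map_one, act_one, zero_add, one_mul]
  mul_one g := by
    change PhaseSemidirect.mk (g.z + act (ι g.k) 0) (g.k * 1) = g
    have h : act (ι g.k) 0 = 0 := by simpa using act_add (ι g.k) 0 0
    rw [h, add_zero, mul_one]
  inv_mul_cancel g := by
    change PhaseSemidirect.mk (act (ι g.k⁻¹) (-g.z) + act (ι g.k⁻¹) g.z) (g.k⁻¹ * g.k) = ⟨0, 1⟩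
    have h : act (ι g.k⁻¹) 0 = 0 := by simpa using act_add (ι g.k⁻¹) 0 0
    rw [← act_add, neg_add_cancel, h, inv_mul_cancel]

/-- The product topology of `ℝ^{2d} × K`. -/
instance [TopologicalSpace K] : TopologicalSpace (PhaseSemidirect ι) :=
  TopologicalSpace.induced (fun h ↦ (h.z, h.k)) inferInstance

instance [TopologicalSpace K] : MeasurableSpace (PhaseSemidirect ι) := borel _

instance [TopologicalSpace K] : BorelSpace (PhaseSemidirect ι) := ⟨rfl⟩

end PhaseSemidirect

/-- The group `G = ℝ^{2d} ⋊ Sp(d, ℝ)`. -/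
abbrev G (d : ℕ) : Type := PhaseSemidirect (MonoidHom.id (Sp d))

/-- The homomorphism `(z, k) ↦ (z, ι(k))` from `ℝ^{2d} ⋊ K` to `G`. -/
def PhaseSemidirect.toG {d : ℕ} {K : Type*} [Group K] (ι : K →* Sp d) :
    PhaseSemidirect ι →* G d where
  toFun h := ⟨h.z, ι h.k⟩
  map_one' := by
    change PhaseSemidirect.mk 0 (ι 1) = ⟨0, 1⟩
    rw [map_one]
  map_mul' g h := by
    change PhaseSemidirect.mk (g.z + act (ι g.k) h.z) (ι (g.k * h.k))
      = ⟨g.z + act (ι g.k) h.z, ι g.k * ι h.k⟩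
    rw [map_mul]

/-- The extended metaplectic representation `μ_e(z, A) = ρ(z, 0) μ(A)` of `G` (up to phases). -/
def extMetaplectic {d : ℕ} (g : G d) : L2 d ≃ₗᵢ[ℂ] L2 d := schrodinger g.z 0 * metaplectic g.k

/-- The group `H`, seen in `G` through `j` and endowed with the left Haar measure `η = dh`, is
reproducing: some `φ` satisfies `f = ∫_H ⟨f, μ_e(h) φ⟩ μ_e(h) φ dh` weakly for all `f ∈ L²(ℝ^d)`,
that is, after pairing with every `g ∈ L²(ℝ^d)`. (The paired integrals converge absolutely; the
inner product of Mathlib is linear in its second argument.) -/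
def IsReproducing {d : ℕ} {H : Type*} [Group H] [MeasurableSpace H] (j : H →* G d)
    (η : Measure H) : Prop :=
  ∃ φ : L2 d, ∀ f g : L2 d,
    Integrable (fun h ↦ inner ℂ (extMetaplectic (j h) φ) f * inner ℂ g (extMetaplectic (j h) φ)) η
    ∧ ∫ h, inner ℂ (extMetaplectic (j h) φ) f * inner ℂ g (extMetaplectic (j h) φ) ∂η
      = inner ℂ g f

/-- The measure `dx dξ dk` on `ℝ^{2d} ⋊ K`, where `dk = ν`. -/
def PhaseSemidirect.prodMeasure {d : ℕ} {K : Type*} [Group K] [TopologicalSpace K]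
    [MeasurableSpace K] (ι : K →* Sp d) (ν : Measure K) : Measure (PhaseSemidirect ι) :=
  ((volume : Measure (Phase d)).prod ν).map fun p ↦ ⟨p.1, p.2⟩

end

end ExtMetaplectic

open ExtMetaplectic

/-! Everything rests on Moyal's identity `∫ |⟨f, ρ(z)φ⟩|² dz = ‖f‖² ‖φ‖²`. For fixed `x`, `⟨f, ρ(x,
ξ)φ⟩` is up to a phase the Fourier transform at `ξ` of `y ↦ conj (φ(y - x)) f(y)`; Plancherel in
`ξ`, then Tonelli and translation invariance in `x`, give the identity
(`lintegral_enorm_sq_inner_schrodinger`). Since `μ(k)` is unitary, replacing `φ` by `μ(k)φ` leaves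
the right side unchanged, so integrating over `K` merely multiplies it by `mes(K)`. Lebesgue measure
times `dk` is a left Haar measure because symplectic matrices have determinant 1.

If `K` is compact, `mes(K)` is finite, `φ` can be scaled so that the constant is 1, and polarization
yields the reproducing formula. If `K` is not compact, `mes(K) = ∞`, so integrability for some `f ≠
0` forces `φ = 0`, which reproduces nothing.

The delicate point is measurability in `k`, as the phase of `μ(k)` is an arbitrary choice. The
modulus squared of a coefficient does not see the phase: `norm_inner_sq_eq_integral` writes it as an
integral in which `μ(k)` has been traded for the linear action of `k⁻¹` on phase space. -/

/-! ### Plancherel's identity for the Fourier integral -/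

/-- On `L¹ ∩ L²` the Fourier transform of `L²` is given by the Fourier integral. -/
theorem fourier_toLp_ae_eq {d : ℕ} {g : Conf d → ℂ} (h1 : Integrable g) (h2 : MemLp g 2) :
    (𝓕 (h2.toLp g) : L2 d) =ᵐ[volume] 𝓕 g := by
  have hcont : Continuous (𝓕 g) :=
    VectorFourier.fourierIntegral_continuous Real.continuous_fourierChar
      (by exact continuous_inner) h1
  refine ae_eq_of_integral_contDiff_smul_eq
    ((Lp.memLp _).locallyIntegrable (by norm_num)) hcont.locallyIntegrable fun s hs hs' ↦ ?_
  have hc : ContDiff ℝ ((⊤ : ℕ∞) : WithTop ℕ∞) fun x ↦ (s x : ℂ) :=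
    Complex.ofRealCLM.contDiff.comp hs
  have hk : HasCompactSupport fun x ↦ (s x : ℂ) :=
    hs'.comp_left (g := fun r : ℝ ↦ (r : ℂ)) Complex.ofReal_zero
  let σ : 𝓢(Conf d, ℂ) := hk.toSchwartzMap hc
  have hσ : ∀ x, σ x = s x := fun _ ↦ rfl
  -- The `L²` transform agrees with the distributional one, which acts by moving `𝓕` onto the test
  -- function.
  have e1 := congrArg (fun T ↦ T σ) (Lp.fourier_toTemperedDistribution_eq (h2.toLp g))
  simp only [TemperedDistribution.fourier_apply, Lp.toTemperedDistribution_apply] at e1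
  have e2 : ∫ x, (𝓕 σ) x • (h2.toLp g) x = ∫ x, (𝓕 σ) x • g x :=
    integral_congr_ae (h2.coeFn_toLp.mono fun x hx ↦ by simp only [hx])
  -- Fubini moves `𝓕` back, this time onto the integrable function `g`.
  have e3 : ∫ x, (𝓕 σ) x • g x = ∫ x, σ x • (𝓕 g) x := by
    have := VectorFourier.integral_fourierIntegral_smul_eq_flip (L := innerₗ (Conf d))
      (μ := volume) (ν := volume) Real.continuous_fourierChar continuous_inner σ.integrable h1
    rw [flip_innerₗ] at this
    rw [SchwartzMap.fourier_coe]
    exact this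
  have := (e1.symm.trans e2).trans e3
  simpa only [hσ, smul_eq_mul, Complex.real_smul] using this

theorem lintegral_enorm_sq {d : ℕ} (f : L2 d) : ∫⁻ y, ‖f y‖ₑ ^ 2 = ‖f‖ₑ ^ 2 := by
  rw [Lp.enorm_def, eLpNorm_eq_lintegral_rpow_enorm_toReal (by simp) (by simp),
    ← ENNReal.rpow_two, ← ENNReal.rpow_mul]
  norm_num

/-- Plancherel's identity on `L¹ ∩ L²`. -/
theorem lintegral_enorm_sq_fourier {d : ℕ} {g : Conf d → ℂ} (h1 : Integrable g)
    (h2 : MemLp g 2) : ∫⁻ ξ, ‖𝓕 g ξ‖ₑ ^ 2 = ∫⁻ y, ‖g y‖ₑ ^ 2 := by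
  calc ∫⁻ ξ, ‖𝓕 g ξ‖ₑ ^ 2 = ∫⁻ ξ, ‖(𝓕 (h2.toLp g) : L2 d) ξ‖ₑ ^ 2 :=
        lintegral_congr_ae ((fourier_toLp_ae_eq h1 h2).mono fun x hx ↦ by simp only [hx])
    _ = ‖(𝓕 (h2.toLp g) : L2 d)‖ₑ ^ 2 := lintegral_enorm_sq _
    _ = ‖h2.toLp g‖ₑ ^ 2 := by
        rw [← ofReal_norm, ← ofReal_norm (h2.toLp g), Lp.norm_fourier_eq]
    _ = ∫⁻ y, ‖(h2.toLp g : L2 d) y‖ₑ ^ 2 := (lintegral_enorm_sq _).symm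
    _ = _ := lintegral_congr_ae (h2.coeFn_toLp.mono fun x hx ↦ by simp only [hx])

/-! ### The short-time Fourier transform and Moyal's identity -/

/-- The matrix coefficient `⟨f, ρ(x, ξ) φ⟩` is, up to a phase, the short-time Fourier transform of
`f` with window `φ`. -/
theorem inner_schrodinger {d : ℕ} (f φ : L2 d) (z : Phase d) :
    inner ℂ (schrodinger z 0 φ) f = Complex.exp ((Real.pi * inner ℝ z.1 z.2 : ℝ) * Complex.I)
      * 𝓕 (fun y ↦ (starRingEnd ℂ) (φ (y - z.1)) * f y) z.2 := by
  rw [L2.inner_def, Real.fourier_eq', ← integral_const_mul]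
  refine integral_congr_ae ((schrodinger_coe z 0 φ).mono fun y hy ↦ ?_)
  -- Conjugation turns the modulation into the Fourier kernel and the factor `e^{-πi⟨x,ξ⟩}` into the
  -- phase of the statement.
  simp only [hy, RCLike.inner_apply, map_mul, ← Complex.exp_conj, smul_eq_mul]
  simp only [map_mul, map_neg, Complex.conj_I, Complex.conj_ofReal, map_ofNat]
  rw [real_inner_comm y z.2]
  have : ∀ a b c e r : ℂ, a * (Complex.exp b * Complex.exp c * Complex.exp e * r)
      = Complex.exp (b + c + e) * (r * a) := by
    intros
    rw [Complex.exp_add, Complex.exp_add]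
    ring
  rw [this, ← mul_assoc (Complex.exp _) (Complex.exp _), ← Complex.exp_add]
  congr 2
  push_cast
  ring

/-- The coefficient is an explicit phase times a parametric integral whose integrand is jointly
measurable, so the continuity of `z ↦ ρ(z)φ` is not needed. -/
theorem measurable_inner_schrodinger {d : ℕ} (f φ : L2 d) :
    StronglyMeasurable fun z : Phase d ↦ inner ℂ (schrodinger z 0 φ) f := by
  simp only [inner_schrodinger, Real.fourier_eq']
  refine StronglyMeasurable.mul (Continuous.stronglyMeasurable (by fun_prop)) ?_
  refine StronglyMeasurable.integral_prod_right
    (f := fun (z : Phase d) (y : Conf d) ↦ Complex.exp (↑(-2 * Real.pi * inner ℝ y z.2) * Complex.I)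
      • ((starRingEnd ℂ) (φ (y - z.1)) * f y)) ?_
  have hφ : Measurable φ := (Lp.stronglyMeasurable φ).measurable
  have hf : Measurable f := (Lp.stronglyMeasurable f).measurable
  refine Measurable.stronglyMeasurable ?_
  have hexp : Measurable fun p : Phase d × Conf d ↦
      Complex.exp (↑(-2 * Real.pi * inner ℝ p.2 p.1.2) * Complex.I) :=
    Continuous.measurable (by fun_prop)
  refine hexp.smul ?_
  refine Measurable.mul (RCLike.continuous_conj.measurable.comp (hφ.comp ?_)) (hf.comp ?_)
  · exact Continuous.measurable (by fun_prop)
  · exact measurable_snd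

/-- Moyal's identity. -/
theorem lintegral_enorm_sq_inner_schrodinger {d : ℕ} (f φ : L2 d) :
    ∫⁻ z : Phase d, ‖inner ℂ (schrodinger z 0 φ) f‖ₑ ^ 2 = ‖f‖ₑ ^ 2 * ‖φ‖ₑ ^ 2 := by
  have hφ : Measurable φ := (Lp.stronglyMeasurable φ).measurable
  have hf : Measurable f := (Lp.stronglyMeasurable f).measurable
  set g : Conf d → Conf d → ℂ := fun x y ↦ (starRingEnd ℂ) (φ (y - x)) * f y with hg
  have hgm : Measurable (Function.uncurry g) :=
    (RCLike.continuous_conj.measurable.comp (hφ.comp (measurable_snd.sub measurable_fst))).mul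
      (hf.comp measurable_snd)
  have hsq : ∫⁻ x, ∫⁻ y, ‖g x y‖ₑ ^ 2 = ‖f‖ₑ ^ 2 * ‖φ‖ₑ ^ 2 := by
    -- With the `x`-integral innermost, `φ(y - x)` contributes `‖φ‖²` independently of `y`.
    rw [lintegral_lintegral_swap (by exact (hgm.enorm.pow_const 2).aemeasurable)]
    simp only [hg, enorm_mul, mul_pow, RCLike.enorm_conj]
    have : ∀ y, ∫⁻ x, ‖φ (y - x)‖ₑ ^ 2 * ‖f y‖ₑ ^ 2 = ‖φ‖ₑ ^ 2 * ‖f y‖ₑ ^ 2 := fun y ↦ by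
      rw [lintegral_mul_const (f := fun x ↦ ‖φ (y - x)‖ₑ ^ 2) _
          ((hφ.comp (measurable_id.const_sub y)).enorm.pow_const 2),
        lintegral_sub_left_eq_self (fun x ↦ ‖φ x‖ₑ ^ 2), lintegral_enorm_sq]
    simp only [this]
    rw [lintegral_const_mul _ (hf.enorm.pow_const 2), lintegral_enorm_sq, mul_comm]
  -- Plancherel is applied slice by slice, and only almost every slice `g x` is square integrable.
  have hfin : ∀ᵐ x, ∫⁻ y, ‖g x y‖ₑ ^ 2 < ∞ := by
    refine ae_lt_top' (hgm.enorm.pow_const 2).lintegral_prod_right'.aemeasurable ?_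
    rw [hsq]
    exact ENNReal.mul_ne_top (by simp) (by simp)
  rw [← hsq, Measure.volume_eq_prod, lintegral_prod _
    ((measurable_inner_schrodinger f φ).measurable.enorm.pow_const 2).aemeasurable]
  refine lintegral_congr_ae (hfin.mono fun x hx ↦ ?_)
  have hgx : Measurable (g x) := hgm.of_uncurry_left
  have h1 : Integrable (g x) := by
    have hm : MemLp (fun y ↦ φ (y - x)) 2 :=
      (Lp.memLp φ).comp_measurePreserving (measurePreserving_sub_right volume x)
    -- Hölder: a product of two `L²` functions is integrable.
    exact (hm.star).integrable_mul (Lp.memLp f)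
  have h2 : MemLp (g x) 2 := by
    refine ⟨hgx.aestronglyMeasurable, ?_⟩
    rw [eLpNorm_lt_top_iff_lintegral_rpow_enorm_lt_top (by simp) (by simp)]
    simpa using hx
  beta_reduce
  rw [← lintegral_enorm_sq_fourier h1 h2]
  refine lintegral_congr fun ξ ↦ ?_
  rw [inner_schrodinger, enorm_mul]
  have : ‖Complex.exp ((Real.pi * inner ℝ x ξ : ℝ) * Complex.I)‖ₑ = 1 := by
    rw [← ofReal_norm, Complex.norm_exp_ofReal_mul_I, ENNReal.ofReal_one]
  rw [this, one_mul]

/-! ### Polarization -/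

/-- Integration of the four-term polarization formula. It serves twice: for the pair of vectors `f`,
`g`, and for the pair of windows `φ`, `ψ`. -/
theorem integral_polarization {α : Type*} [MeasurableSpace α] {μ : Measure α}
    {p q r s : α → ℂ} (hp : Integrable p μ) (hq : Integrable q μ) (hr : Integrable r μ)
    (hs : Integrable s μ) :
    Integrable (fun a ↦ (p a - q a + (r a - s a) * Complex.I) / 4) μ ∧
      ∫ a, (p a - q a + (r a - s a) * Complex.I) / 4 ∂μ
        = (∫ a, p a ∂μ - ∫ a, q a ∂μ + (∫ a, r a ∂μ - ∫ a, s a ∂μ) * Complex.I) / 4 := by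
  have h1 : Integrable (fun a ↦ p a - q a) μ := hp.sub hq
  have h2 : Integrable (fun a ↦ (r a - s a) * Complex.I) μ := (hr.sub hs).mul_const _
  refine ⟨(h1.add h2).div_const 4, ?_⟩
  rw [integral_div, integral_add h1 h2, integral_mul_const, integral_sub hp hq,
    integral_sub hr hs]

/-- Polarization: a family `v` of vectors with `∫ |⟨f, v⟩|² = c ‖f‖²` is a weak resolution of `c`
times the identity. -/
theorem integral_inner_mul_inner {α E : Type*} [MeasurableSpace α] [NormedAddCommGroup E]
    [InnerProductSpace ℂ E] {μ : Measure α} {v : α → E} {c : ℝ≥0∞} (hc : c ≠ ∞)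
    (hm : ∀ f, Measurable fun a ↦ ‖inner ℂ (v a) f‖ₑ ^ 2)
    (hv : ∀ f, ∫⁻ a, ‖inner ℂ (v a) f‖ₑ ^ 2 ∂μ = ‖f‖ₑ ^ 2 * c) (f g : E) :
    Integrable (fun a ↦ inner ℂ (v a) f * inner ℂ g (v a)) μ ∧
      ∫ a, inner ℂ (v a) f * inner ℂ g (v a) ∂μ = c.toReal * inner ℂ g f := by
  have hr : ∀ f, (fun a ↦ ((‖inner ℂ (v a) f‖ : ℂ)) ^ 2)
      = fun a ↦ (((‖inner ℂ (v a) f‖ₑ ^ 2).toReal : ℝ) : ℂ) := fun f ↦ by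
    ext a; simp
  have hfin : ∀ f, ∫⁻ a, ‖inner ℂ (v a) f‖ₑ ^ 2 ∂μ ≠ ∞ := fun f ↦ by
    rw [hv]; exact ENNReal.mul_ne_top (by simp) hc
  have hi : ∀ f, Integrable (fun a ↦ ((‖inner ℂ (v a) f‖ : ℂ)) ^ 2) μ := fun f ↦ by
    rw [hr]
    exact (integrable_toReal_of_lintegral_ne_top (hm f).aemeasurable (hfin f)).ofReal
  have hI : ∀ f, ∫ a, ((‖inner ℂ (v a) f‖ : ℂ)) ^ 2 ∂μ = c.toReal * (‖f‖ : ℂ) ^ 2 := fun f ↦ by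
    rw [hr, integral_complex_ofReal, integral_toReal (hm f).aemeasurable
      (ae_lt_top (hm f) (hfin f)), hv, ENNReal.toReal_mul]
    simp [mul_comm]
  -- Polarization in the inner product space `ℂ`, applied to the scalars `⟨v a, g⟩` and `⟨v a, f⟩`.
  have hpol : ∀ a, inner ℂ (v a) f * inner ℂ g (v a)
      = ((‖inner ℂ (v a) (g + f)‖ : ℂ) ^ 2 - (‖inner ℂ (v a) (g - f)‖ : ℂ) ^ 2
        + ((‖inner ℂ (v a) (g - Complex.I • f)‖ : ℂ) ^ 2
          - (‖inner ℂ (v a) (g + Complex.I • f)‖ : ℂ) ^ 2) * Complex.I) / 4 := fun a ↦ by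
    rw [← inner_conj_symm g (v a)]
    have := inner_eq_sum_norm_sq_div_four (𝕜 := ℂ) (inner ℂ (v a) g) (inner ℂ (v a) f)
    simp only [RCLike.inner_apply, smul_eq_mul, RCLike.I_to_complex, Complex.coe_algebraMap] at this
    simpa only [inner_add_right, inner_sub_right, inner_smul_right] using this
  simp only [hpol]
  obtain ⟨h1, h2⟩ := integral_polarization (hi (g + f)) (hi (g - f)) (hi (g - Complex.I • f))
    (hi (g + Complex.I • f))
  refine ⟨h1, ?_⟩
  have h3 := inner_eq_sum_norm_sq_div_four (𝕜 := ℂ) g f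
  simp only [RCLike.I_to_complex] at h3
  rw [h2, hI, hI, hI, hI, h3]
  simp only [Complex.coe_algebraMap]
  ring

theorem integral_inner_schrodinger_self {d : ℕ} (φ f g : L2 d) :
    Integrable (fun z : Phase d ↦
        inner ℂ (schrodinger z 0 φ) f * inner ℂ g (schrodinger z 0 φ)) ∧
      ∫ z : Phase d, inner ℂ (schrodinger z 0 φ) f * inner ℂ g (schrodinger z 0 φ)
        = (‖φ‖ : ℂ) ^ 2 * inner ℂ g f := by
  have := integral_inner_mul_inner (μ := (volume : Measure (Phase d)))
    (v := fun z ↦ schrodinger z 0 φ) (c := ‖φ‖ₑ ^ 2) (by simp)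
    (fun f ↦ (measurable_inner_schrodinger f φ).measurable.enorm.pow_const 2)
    (fun f ↦ lintegral_enorm_sq_inner_schrodinger f φ) f g
  simpa using this

/-- The polarized form of Moyal's identity. -/
theorem integral_inner_schrodinger {d : ℕ} (φ ψ f g : L2 d) :
    ∫ z : Phase d, inner ℂ (schrodinger z 0 φ) f * inner ℂ g (schrodinger z 0 ψ)
      = inner ℂ φ ψ * inner ℂ g f := by
  set P : L2 d → Phase d → ℂ := fun φ z ↦
    inner ℂ (schrodinger z 0 φ) f * inner ℂ g (schrodinger z 0 φ)
  have hi : ∀ φ, Integrable (P φ) := fun φ ↦ (integral_inner_schrodinger_self φ f g).1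
  have hI : ∀ φ, ∫ z, P φ z = (‖φ‖ : ℂ) ^ 2 * inner ℂ g f := fun φ ↦
    (integral_inner_schrodinger_self φ f g).2
  -- For fixed `f` and `g` the integrand is sesquilinear in the windows, hence determined by its
  -- diagonal `P`.
  have hpol : ∀ z : Phase d, inner ℂ (schrodinger z 0 φ) f * inner ℂ g (schrodinger z 0 ψ)
      = (P (φ + ψ) z - P (φ - ψ) z
        + (P (φ - Complex.I • ψ) z - P (φ + Complex.I • ψ) z) * Complex.I) / 4 := fun z ↦ by
    simp only [P, map_add, map_sub, map_smul, inner_add_left, inner_add_right, inner_sub_left,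
      inner_sub_right, inner_smul_left, inner_smul_right, Complex.conj_I]
    ring_nf
    simp only [Complex.I_sq]
    ring
  simp only [hpol]
  have h2 := (integral_polarization (hi (φ + ψ)) (hi (φ - ψ)) (hi (φ - Complex.I • ψ))
    (hi (φ + Complex.I • ψ))).2
  have h3 := inner_eq_sum_norm_sq_div_four (𝕜 := ℂ) φ ψ
  simp only [RCLike.I_to_complex] at h3
  rw [h2, hI, hI, hI, hI, h3]
  simp only [Complex.coe_algebraMap]
  ring

/-! ### The symplectic action on phase space -/

theorem continuous_act {d : ℕ} : Continuous fun p : Sp d × Phase d ↦ act p.1 p.2 := by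
  have h : Continuous fun p : Sp d × Phase d ↦
      Matrix.mulVec p.1.1 (Sum.elim p.2.1 p.2.2 : Fin d ⊕ Fin d → ℝ) := by
    refine Continuous.matrix_mulVec (continuous_subtype_val.comp continuous_fst) ?_
    refine continuous_pi fun i ↦ ?_
    rcases i with i | i <;> simp only [Sum.elim_inl, Sum.elim_inr] <;> fun_prop
  refine Continuous.prodMk ?_ ?_
  · exact (PiLp.continuous_toLp 2 _).comp
      (continuous_pi fun i ↦ (continuous_apply (Sum.inl i)).comp h)
  · exact (PiLp.continuous_toLp 2 _).comp
      (continuous_pi fun i ↦ (continuous_apply (Sum.inr i)).comp h)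

theorem isAddHaarMeasure_volume_phase (d : ℕ) :
    (volume : Measure (Phase d)).IsAddHaarMeasure := by
  rw [Measure.volume_eq_prod]
  infer_instance

/-- The coordinates of phase space. -/
def phaseCoord (d : ℕ) : Phase d ≃ₗ[ℝ] (Fin d ⊕ Fin d → ℝ) where
  toFun z := Sum.elim z.1 z.2
  invFun v := (WithLp.toLp 2 fun i ↦ v (Sum.inl i), WithLp.toLp 2 fun i ↦ v (Sum.inr i))
  left_inv _ := rfl
  right_inv v := by ext i; cases i <;> rfl
  map_add' z z' := by ext i; cases i <;> rfl
  map_smul' a z := by ext i; cases i <;> rfl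

/-- Symplectic matrices preserve the Lebesgue measure of phase space. -/
theorem measurePreserving_act {d : ℕ} (A : Sp d) :
    MeasurePreserving (act A) (volume : Measure (Phase d)) volume := by
  have := isAddHaarMeasure_volume_phase d
  set T : Phase d →ₗ[ℝ] Phase d :=
    (phaseCoord d).symm.toLinearMap ∘ₗ Matrix.toLin' A.1 ∘ₗ (phaseCoord d).toLinearMap with hT
  have hTA : ⇑T = act A := rfl
  -- The determinant is invariant under the change of coordinates, and a symplectic matrix has
  -- determinant 1.
  have hdet : LinearMap.det T = 1 := by
    have := LinearMap.det_conj (Matrix.toLin' A.1) (phaseCoord d).symm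
    rw [LinearEquiv.symm_symm] at this
    rw [hT, this, LinearMap.det_toLin', SymplecticGroup.det_eq_one A.2]
  refine ⟨(continuous_act.comp (Continuous.prodMk_right A)).measurable, ?_⟩
  have := Measure.map_linearMap_addHaar_eq_smul_addHaar (volume : Measure (Phase d))
    (f := T) (by simp [hdet])
  rw [← hTA, this, hdet]
  simp

/-! ### Coefficients without the metaplectic operator -/

/-- The intertwining relation, read as an identity of matrix coefficients, expresses
`|⟨f, ρ(w) U φ⟩|²` through the Wigner-type functions of `f` and `φ` alone. -/
theorem norm_inner_sq_eq_integral {d : ℕ} {A : Sp d} {U : L2 d ≃ₗᵢ[ℂ] L2 d}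
    (hU : IsMetaplectic A U) (w : Phase d) (f φ : L2 d) :
    (‖inner ℂ (schrodinger w 0 (U φ)) f‖ : ℂ) ^ 2 = ∫ z : Phase d,
      Complex.exp (2 * Real.pi * Complex.I * (inner ℝ w.1 z.2 - inner ℝ w.2 z.1 : ℝ))
        * inner ℂ (schrodinger z 0 f) f
        * (starRingEnd ℂ) (inner ℂ (schrodinger (act A⁻¹ z) 0 φ) φ) := by
  set b : L2 d := (schrodinger w 0)⁻¹ f with hb
  have hwb : schrodinger w 0 b = f := (schrodinger w 0).apply_symm_apply f
  have h1 : inner ℂ (schrodinger w 0 (U φ)) f = inner ℂ (U φ) b := by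
    conv_lhs => rw [← hwb, LinearIsometryEquiv.inner_map_map]
  have h2 : (‖inner ℂ (U φ) b‖ : ℂ) ^ 2 = inner ℂ b (U φ) * inner ℂ (U φ) b := by
    rw [← inner_conj_symm b (U φ), mul_comm, Complex.mul_conj']
  -- Moyal's identity read backwards: the product `⟨b, U φ⟩⟨U φ, b⟩` becomes an integral of a
  -- diagonal coefficient of `b` against one of `U φ`.
  rw [h1, h2, ← integral_inner_schrodinger b (U φ) b (U φ)]
  refine integral_congr_ae (Filter.Eventually.of_forall fun z ↦ ?_)
  beta_reduce
  congr 1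
  -- Commuting `ρ(w)` past `ρ(z)` costs only a scalar, the symplectic character of the statement;
  -- `b` is thereby replaced by `f`.
  · have h3 : schrodinger w 0 (schrodinger z 0 b)
        = Complex.exp (2 * Real.pi * Complex.I * (-(inner ℝ w.1 z.2 - inner ℝ w.2 z.1) : ℝ))
          • schrodinger z 0 f := by
      have h4 : schrodinger w 0 * schrodinger z 0
          = schrodinger z (-(inner ℝ w.1 z.2 - inner ℝ w.2 z.1)) * schrodinger w 0 := by
        rw [schrodinger_mul, schrodinger_mul, add_comm w z, real_inner_comm w.1 z.2,
          real_inner_comm w.2 z.1]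
        congr 1
        ring
      have h5 := congrArg (fun V : L2 d ≃ₗᵢ[ℂ] L2 d ↦ V b) h4
      simp only [LinearIsometryEquiv.coe_mul, Function.comp_apply] at h5
      rw [h5, hwb, schrodinger_phase]
    rw [← LinearIsometryEquiv.inner_map_map (schrodinger w 0), h3, hwb, inner_smul_left,
      ← Complex.exp_conj]
    congr 2
    simp only [map_mul, Complex.conj_I, Complex.conj_ofReal, map_ofNat]
    push_cast
    ring
  -- Intertwining at `A⁻¹ z` reads `ρ(z) U = U ρ(A⁻¹ z)`, and unitarity then removes `U`.
  · have h3 := hU (act A⁻¹ z) 0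
    rw [← act_mul, mul_inv_cancel, act_one, eq_mul_inv_iff_mul_eq] at h3
    have h4 := congrArg (fun V : L2 d ≃ₗᵢ[ℂ] L2 d ↦ V φ) h3
    simp only [LinearIsometryEquiv.coe_mul, Function.comp_apply] at h4
    rw [h4, LinearIsometryEquiv.inner_map_map, inner_conj_symm]

/-! ### Topology, Haar measure and the reproducing property of the semidirect product -/

section PhaseSemidirect

variable {d : ℕ} {K : Type*} [Group K] [TopologicalSpace K] {ι : K →* Sp d}

/-- The underlying product space of `ℝ^{2d} ⋊ K`. -/
def phaseSemidirectHomeomorph (ι : K →* Sp d) : PhaseSemidirect ι ≃ₜ Phase d × K where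
  toFun h := (h.z, h.k)
  invFun p := ⟨p.1, p.2⟩
  left_inv _ := rfl
  right_inv _ := rfl
  continuous_toFun := continuous_induced_dom
  continuous_invFun := continuous_induced_rng.2 continuous_id

/-- Needed for the uniqueness of Haar measure. Continuity of `ι` enters through the joint continuity
of the action. -/
theorem isTopologicalGroup_phaseSemidirect [IsTopologicalGroup K] (hι : Continuous ι) :
    IsTopologicalGroup (PhaseSemidirect ι) := by
  have hz : Continuous fun h : PhaseSemidirect ι ↦ h.z :=
    continuous_fst.comp (phaseSemidirectHomeomorph ι).continuous
  have hk : Continuous fun h : PhaseSemidirect ι ↦ h.k :=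
    continuous_snd.comp (phaseSemidirectHomeomorph ι).continuous
  refine { continuous_mul := ?_, continuous_inv := ?_ }
  · refine continuous_induced_rng.2 (Continuous.prodMk (f := fun p : PhaseSemidirect ι ×
      PhaseSemidirect ι ↦ p.1.z + act (ι p.1.k) p.2.z) (g := fun p ↦ p.1.k * p.2.k) ?_ ?_)
    · exact (hz.comp continuous_fst).add (continuous_act.comp
        ((hι.comp (hk.comp continuous_fst)).prodMk (hz.comp continuous_snd)))
    · exact (hk.comp continuous_fst).mul (hk.comp continuous_snd)
  · exact continuous_induced_rng.2 (Continuous.prodMk (f := fun h : PhaseSemidirect ι ↦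
      act (ι h.k⁻¹) (-h.z)) (g := fun h ↦ h.k⁻¹)
      (continuous_act.comp ((hι.comp hk.inv).prodMk hz.neg)) hk.inv)

theorem prodMeasure_eq_map [SecondCountableTopology K] [MeasurableSpace K] [BorelSpace K]
    (ν : Measure K) : PhaseSemidirect.prodMeasure ι ν
      = ((volume : Measure (Phase d)).prod ν).map
        (phaseSemidirectHomeomorph ι).symm.toMeasurableEquiv := rfl

variable [IsTopologicalGroup K] [SecondCountableTopology K] [MeasurableSpace K] [BorelSpace K]

/-- `metaplectic` is defined by choice, so no regularity in `k` is available directly. In the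
integral of `norm_inner_sq_eq_integral`, however, `k` occurs only through the continuous map `(k, z)
↦ act (ι k)⁻¹ z`, and the integrand is jointly measurable. -/
theorem measurable_inner_extMetaplectic (hι : Continuous ι) (f φ : L2 d) :
    Measurable fun h : PhaseSemidirect ι ↦
      ‖inner ℂ (extMetaplectic (PhaseSemidirect.toG ι h) φ) f‖ₑ ^ 2 := by
  have hF : StronglyMeasurable fun p : Phase d × K ↦
      (‖inner ℂ (schrodinger p.1 0 (metaplectic (ι p.2) φ)) f‖ : ℂ) ^ 2 := by
    simp only [norm_inner_sq_eq_integral (isMetaplectic_metaplectic _)]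
    refine StronglyMeasurable.integral_prod_right (f := fun (p : Phase d × K) (z : Phase d) ↦
      Complex.exp (2 * Real.pi * Complex.I * (inner ℝ p.1.1 z.2 - inner ℝ p.1.2 z.1 : ℝ))
        * inner ℂ (schrodinger z 0 f) f
        * (starRingEnd ℂ) (inner ℂ (schrodinger (act (ι p.2)⁻¹ z) 0 φ) φ)) ?_
    have h1 : Measurable fun q : (Phase d × K) × Phase d ↦ Complex.exp (2 * Real.pi * Complex.I
        * (inner ℝ q.1.1.1 q.2.2 - inner ℝ q.1.1.2 q.2.1 : ℝ)) :=
      Continuous.measurable (by fun_prop)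
    have h2 : Measurable fun q : (Phase d × K) × Phase d ↦ act (ι q.1.2)⁻¹ q.2 := by
      simp only [← map_inv]
      exact (continuous_act.comp ((hι.comp (continuous_snd.comp continuous_fst).inv).prodMk
        continuous_snd)).measurable
    exact ((h1.mul ((measurable_inner_schrodinger f f).measurable.comp measurable_snd)).mul
      (RCLike.continuous_conj.measurable.comp
        ((measurable_inner_schrodinger φ φ).measurable.comp h2))).stronglyMeasurable
  have h := (hF.measurable.comp (phaseSemidirectHomeomorph ι).continuous.measurable).enorm
  convert h using 2 with h
  simp only [Function.comp_apply, enorm_pow, phaseSemidirectHomeomorph]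
  rw [← ofReal_norm (( _ : ℝ) : ℂ), Complex.norm_real, norm_norm, ofReal_norm]
  rfl

variable [LocallyCompactSpace K]

/-- The product of Lebesgue measure and a left Haar measure of `K` is a left Haar measure of
`ℝ^{2d} ⋊ K`. -/
theorem isHaarMeasure_prodMeasure (ν : Measure K) [ν.IsHaarMeasure] :
    (PhaseSemidirect.prodMeasure ι ν).IsHaarMeasure := by
  have := isAddHaarMeasure_volume_phase d
  set e := phaseSemidirectHomeomorph ι
  have hmap (s : Set (PhaseSemidirect ι)) : PhaseSemidirect.prodMeasure ι ν s
      = ((volume : Measure (Phase d)).prod ν) (e.symm ⁻¹' s) := by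
    rw [prodMeasure_eq_map, MeasurableEquiv.map_apply]
    rfl
  refine { lt_top_of_isCompact := fun s hs ↦ ?_, map_mul_left_eq_self := fun g ↦ ?_,
           open_pos := fun s hs hne ↦ ?_ }
  · rw [hmap]
    exact (e.symm.isCompact_preimage.2 hs).measure_lt_top
  -- For a fixed `g`, left translation is a product map: an affine symplectic map of phase space
  -- times left translation of `K`. Each factor preserves its measure.
  · have hz : MeasurePreserving (fun z ↦ g.z + act (ι g.k) z) (volume : Measure (Phase d)) volume :=
      (measurePreserving_add_left volume g.z).comp (measurePreserving_act (ι g.k))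
    have hk : MeasurePreserving (fun k ↦ g.k * k) ν ν := measurePreserving_mul_left ν g.k
    have he : MeasurePreserving e.symm.toMeasurableEquiv
        ((volume : Measure (Phase d)).prod ν) (PhaseSemidirect.prodMeasure ι ν) :=
      ⟨e.symm.toMeasurableEquiv.measurable, rfl⟩
    have := (he.comp (hz.prod hk)).comp he.symm
    exact this.map_eq
  · rw [hmap]
    exact (hs.preimage e.symm.continuous).measure_ne_zero _ (hne.preimage e.symm.surjective)

theorem lintegral_enorm_sq_inner_extMetaplectic (hι : Continuous ι) (ν : Measure K)
    [ν.IsHaarMeasure] (f φ : L2 d) :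
    ∫⁻ h, ‖inner ℂ (extMetaplectic (PhaseSemidirect.toG ι h) φ) f‖ₑ ^ 2
        ∂(PhaseSemidirect.prodMeasure ι ν) = ‖f‖ₑ ^ 2 * ‖φ‖ₑ ^ 2 * ν Set.univ := by
  have hm := measurable_inner_extMetaplectic hι f φ
  rw [prodMeasure_eq_map, lintegral_map_equiv, lintegral_prod_symm]
  -- After Tonelli the inner integral is Moyal's identity with window `μ(k)φ`, whose norm is `‖φ‖`;
  -- it does not depend on `k`.
  · have : ∀ k : K, ∫⁻ z : Phase d, ‖inner ℂ (extMetaplectic (PhaseSemidirect.toG ι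
        ((phaseSemidirectHomeomorph ι).symm.toMeasurableEquiv (z, k))) φ) f‖ₑ ^ 2
        = ‖f‖ₑ ^ 2 * ‖φ‖ₑ ^ 2 := fun k ↦ by
      rw [← ofReal_norm φ, ← (metaplectic (ι k)).norm_map φ, ofReal_norm,
        ← lintegral_enorm_sq_inner_schrodinger]
      rfl
    simp only [this, lintegral_const]
  · exact (hm.comp (MeasurableEquiv.measurable _)).aemeasurable

/-- The group `ℝ^{2d} ⋊ K` is reproducing if and only if `K` is compact. -/
theorem isReproducing_iff_compactSpace (hι : Continuous ι) (η : Measure (PhaseSemidirect ι))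
    [η.IsHaarMeasure] : IsReproducing (PhaseSemidirect.toG ι) η ↔ CompactSpace K := by
  have := isTopologicalGroup_phaseSemidirect hι
  have : LocallyCompactSpace (PhaseSemidirect ι) :=
    (phaseSemidirectHomeomorph ι).isClosedEmbedding.locallyCompactSpace
  have : SecondCountableTopology (PhaseSemidirect ι) :=
    (phaseSemidirectHomeomorph ι).isEmbedding.secondCountableTopology
  set ν : Measure K := Measure.haar
  have := isHaarMeasure_prodMeasure (ι := ι) ν
  set c := Measure.haarScalarFactor η (PhaseSemidirect.prodMeasure ι ν)
  -- Uniqueness of Haar measure: an arbitrary `η` differs from the product measure by a positive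
  -- finite factor.
  have hη : η = c • PhaseSemidirect.prodMeasure ι ν := Measure.isMulLeftInvariant_eq_smul _ _
  have hc : (c : ℝ≥0∞) ≠ 0 := by
    exact_mod_cast (Measure.haarScalarFactor_pos_of_isHaarMeasure η _).ne'
  have hν : ν Set.univ ≠ 0 := isOpen_univ.measure_ne_zero ν Set.univ_nonempty
  have hint : ∀ f φ : L2 d, ∫⁻ h, ‖inner ℂ (extMetaplectic (PhaseSemidirect.toG ι h) φ) f‖ₑ ^ 2 ∂η
      = ‖f‖ₑ ^ 2 * (‖φ‖ₑ ^ 2 * (c * ν Set.univ)) := fun f φ ↦ by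
    rw [hη, lintegral_smul_measure, lintegral_enorm_sq_inner_extMetaplectic hι, ENNReal.smul_def,
      smul_eq_mul]
    ring
  -- On a zero space every group would be reproducing. The indicator of the unit ball is a nonzero
  -- element, also for `d = 0`.
  have hne : Nontrivial (L2 d) := by
    refine ⟨⟨indicatorConstLp 2 (Metric.isOpen_ball (x := (0 : Conf d)) (ε := 1)).measurableSet
      measure_ball_lt_top.ne (1 : ℂ), 0, fun h ↦ ?_⟩⟩
    have h1 := congrArg norm h
    rw [norm_indicatorConstLp (by simp) (by simp), norm_zero] at h1
    simp only [norm_one, one_mul] at h1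
    refine (Real.rpow_pos_of_pos ?_ _).ne' h1
    exact ENNReal.toReal_pos (Metric.measure_ball_pos _ _ one_pos).ne' measure_ball_lt_top.ne
  constructor
  · rintro ⟨φ, hφ⟩
    obtain ⟨f, hf⟩ := exists_ne (0 : L2 d)
    by_contra hK
    rw [not_compactSpace_iff] at hK
    -- A noncompact locally compact group has infinite Haar measure.
    have htop : ν Set.univ = ∞ := measure_univ_of_isMulLeftInvariant ν
    -- On the diagonal, integrability says that `‖f‖² ‖φ‖² · ∞` is finite, which leaves only `φ =
    -- 0`; the formula would then give `⟨f, f⟩ = 0`.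
    obtain ⟨h1, h2⟩ := hφ f f
    have hfin := h1.hasFiniteIntegral
    simp only [HasFiniteIntegral, enorm_mul] at hfin
    have hsq : ∀ a : L2 d, ‖inner ℂ a f‖ₑ * ‖inner ℂ f a‖ₑ = ‖inner ℂ a f‖ₑ ^ 2 := fun a ↦ by
      rw [← inner_conj_symm f a, RCLike.enorm_conj, sq]
    simp only [hsq, hint, htop] at hfin
    have hφ0 : φ = 0 := by
      by_contra hφ0
      refine hfin.ne ?_
      rw [ENNReal.mul_top hc, ENNReal.mul_top (by simpa using hφ0),
        ENNReal.mul_top (by simpa using hf)]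
    rw [hφ0] at h2
    simp only [map_zero, inner_zero_left, zero_mul, integral_zero] at h2
    exact hf (inner_self_eq_zero.1 h2.symm)
  · intro hK
    have hfin : c * ν Set.univ ≠ ∞ := ENNReal.mul_ne_top (by simp) isCompact_univ.measure_lt_top.ne
    set r : ℝ := (c * ν Set.univ).toReal
    have hr : 0 < r := ENNReal.toReal_pos (mul_ne_zero hc hν) hfin
    -- Only the norm of `φ` matters: `‖φ‖² = 1 / r` cancels the total mass `r = c · mes(K)`.
    obtain ⟨φ, hφ⟩ := exists_norm_eq (L2 d) (c := (Real.sqrt r)⁻¹) (by positivity)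
    have hone : ‖φ‖ₑ ^ 2 * (c * ν Set.univ) = 1 := by
      rw [← ENNReal.ofReal_toReal hfin, ← ofReal_norm, hφ, ← ENNReal.ofReal_pow (by positivity),
        ← ENNReal.ofReal_mul (by positivity), inv_pow, Real.sq_sqrt hr.le,
        inv_mul_cancel₀ hr.ne', ENNReal.ofReal_one]
    refine ⟨φ, fun f g ↦ ?_⟩
    have := integral_inner_mul_inner (μ := η)
      (v := fun h ↦ extMetaplectic (PhaseSemidirect.toG ι h) φ) (c := 1) (by simp)
      (fun f ↦ measurable_inner_extMetaplectic hι f φ) (fun f ↦ by rw [hint, hone]) f g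
    simpa using this

end PhaseSemidirect

theorem proposition3p6 (d : ℕ) {K : Type*} [Group K] [TopologicalSpace K] [IsTopologicalGroup K]
    [LocallyCompactSpace K] [SecondCountableTopology K] [MeasurableSpace K] [BorelSpace K]
    (ι : K →* Sp d) (hι : Continuous ι) (hinj : Function.Injective ι) :
    (∀ η : Measure (PhaseSemidirect ι), η.IsHaarMeasure →
      (IsReproducing (PhaseSemidirect.toG ι) η ↔ CompactSpace K)) ∧
    ∀ ν : Measure K, ν.IsHaarMeasure →
      (PhaseSemidirect.prodMeasure ι ν).IsHaarMeasure ∧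
      ∀ f φ : L2 d,
        Measurable (fun h : PhaseSemidirect ι ↦
          ‖inner ℂ (extMetaplectic (PhaseSemidirect.toG ι h) φ) f‖ₑ ^ 2) ∧
        ∫⁻ h, ‖inner ℂ (extMetaplectic (PhaseSemidirect.toG ι h) φ) f‖ₑ ^ 2
            ∂(PhaseSemidirect.prodMeasure ι ν)
          = ‖f‖ₑ ^ 2 * ‖φ‖ₑ ^ 2 * ν Set.univ := by
  exact ⟨fun η _ ↦ isReproducing_iff_compactSpace hι η, fun ν _ ↦
    ⟨isHaarMeasure_prodMeasure ν, fun f φ ↦ ⟨measurable_inner_extMetaplectic hι f φ,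
      lintegral_enorm_sq_inner_extMetaplectic hι ν f φ⟩⟩⟩
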